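/- For a real quadratic field $K$ with ring of integers $\mathcal O_K$, call $a\in\mathcal O_K$ totally positive if $a$ and its conjugate are both positive. A quadratic form $Q$ in $M$ variables with coefficients in $\mathcal O_K$ is called classical if its off-diagonal coefficients are divisible by $2$ in $\mathcal O_K$, totally positive if it and its conjugate form are positive definite (equivalently, $Q(x)$ is totally positive for all $0\ne x\in\mathcal O_K^M$), and universal if it represents every totally positive element of $\mathcal O_K$ by a vector of $\mathcal O_K^M$. **Theorem.** Let $M$ be a positive integer. There are infinitely many real quadratic fields that admit no classical totally positive universal quadratic form in $M$ variables. More precisely, let $u\ge 6$ be an integer with $u\equiv 2\pmod 4$ and $\frac{u^2}{4}+1$ squarefree (for instance $u=6$), and let $\ell\ge 4M+2$ be odd. Then there are infinitely many real quadratic fields $K=\mathbb Q(\sqrt D)$, with $D\equiv 2\pmod 4$ squarefree and $$\sqrt D=[k;\overline{u,\dots,u,2k}]$$ for some positive integer $k$ (the period consisting of $\ell$ copies of $u$ followed by $2k$), that admit no classical totally positive universal quadratic form in $M$ variables. -/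

import Mathlib

open scoped NumberField IntermediateField

/-- An algebraic integer of `K` is totally positive if every real embedding of `K` sends it to a
positive number. (For a real quadratic field this means `a > 0` and `a' > 0`.) -/
def TotallyPositive (K : Type*) [Field K] (a : 𝓞 K) : Prop :=
  ∀ σ : K →+* ℝ, 0 < σ (a : K)

/-- A quadratic form in `M` variables with coefficients in `𝓞 K` is classical if its off-diagonal
coefficients are divisible by `2`. The coefficient of `x i * x j` (`i ≠ j`) is the polar form
`Q (e i + e j) - Q (e i) - Q (e j)` at the standard basis vectors `e i`, `e j`. -/
def IsClassical {K : Type*} [Field K] {M : ℕ} (Q : QuadraticForm (𝓞 K) (Fin M → 𝓞 K)) : Prop :=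
  ∀ i j : Fin M, i ≠ j →
    (2 : 𝓞 K) ∣ QuadraticMap.polar Q (Pi.single i (1 : 𝓞 K)) (Pi.single j (1 : 𝓞 K))

/-- A quadratic form over `𝓞 K` is totally positive if all its values at nonzero vectors are totally
positive, that is, if the form and its conjugates are positive definite. -/
def IsTotallyPositiveForm {K : Type*} [Field K] {M : ℕ}
    (Q : QuadraticForm (𝓞 K) (Fin M → 𝓞 K)) : Prop :=
  ∀ x : Fin M → 𝓞 K, x ≠ 0 → TotallyPositive K (Q x)

/-- A quadratic form over `𝓞 K` is universal if it represents all totally positive integers. -/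
def IsUniversalForm {K : Type*} [Field K] {M : ℕ}
    (Q : QuadraticForm (𝓞 K) (Fin M → 𝓞 K)) : Prop :=
  ∀ a : 𝓞 K, TotallyPositive K a → ∃ x : Fin M → 𝓞 K, Q x = a

/-- `K` admits a classical totally positive universal quadratic form in `M` variables. -/
def AdmitsClassicalUniversalForm (K : Type*) [Field K] (M : ℕ) : Prop :=
  ∃ Q : QuadraticForm (𝓞 K) (Fin M → 𝓞 K),
    IsClassical Q ∧ IsTotallyPositiveForm Q ∧ IsUniversalForm Q

/-- The simple continued fraction expansion of `v` is `[k; u, …, u, 2k, u, …, u, 2k, …]`, with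
period `u, …, u, 2k` containing `ℓ` copies of `u`. (`partDens.get? n` is the partial quotient
with index `n + 1`.) -/
def HasPeriodicExpansion (v : ℝ) (k u ℓ : ℕ) : Prop :=
  (GenContFract.of v).h = (k : ℝ) ∧
    ∀ n : ℕ, (GenContFract.of v).partDens.get? n =
      some (if n % (ℓ + 1) = ℓ then 2 * (k : ℝ) else (u : ℝ))

/-!
For `ω = √D` consider the elements `Wₙ ∈ ℤ[ω]` with `W₀ = 1`, `W₁ = k + ω`, `Wₙ₊₂ = u Wₙ₊₁ + Wₙ`;
for `1 ≤ n ≤ ℓ + 1` they are the `pₙ₋₁ + qₙ₋₁ √D` with `pₙ₋₁ / qₙ₋₁` a convergent of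
`√D = [k; u, …, u, 2k]`. The shape of the expansion amounts to the
single relation `W_{ℓ+1} (ω - k) = W_ℓ`, and this relation forces the conjugates to be
`Wₙ' = (-1)ⁿ W_{ℓ+1-n} / W_{ℓ+1}` for `n ≤ ℓ + 1` (`recSeq_conj`). Hence the `Wₙ` with `n ≤ ℓ + 1`
even are totally positive, and conjugation reverses their order.

**No universal form.** Suppose that a classical totally positive form `Q` represents `W_{2i}` and
`W_{2j}`, with `i < j`, by vectors `v`, `w`. Half of the polar form of `v`, `w` is an integer `b`
with `b² ≤ W_{2i} W_{2j}` in both embeddings, by Cauchy–Schwarz. Put `m = i + j`. The identity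
`recSeq_mul_sub_sq` gives `W_{2i} W_{2j} < W_m²`, and, by the symmetry above, the same holds for
the conjugates. Since `W_m, W_{m-1}` is a `ℤ`-basis of the ring of integers `ℤ[ω]`, we can write
`b = c W_m + d W_{m-1}`; the conjugates of the two basis elements have opposite signs, so one of
the two embeddings of `b` has no cancellation, which forces `b = 0`
(`eq_zero_of_sq_le_recSeq_mul`). So the vectors representing `W_0, W_2, …, W_{2M}` are pairwise
orthogonal, hence linearly independent, which is impossible in `M` variables.

**Infinitely many `D`.** Let `Uₙ` be the same recurrence started at `0, 1`. For `ℓ = 2r + 1` the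
expansion has the required shape when `(D - k²) U_{ℓ+1} = 2 k U_ℓ + U_{ℓ-1}`. The solutions `(k, D)`
form a one-parameter family in which `k` is linear in the parameter `t` and `D` is a product of two
linear polynomials in `t` with resultant `±1` (`exists_radicand`). A suitable residue class of `t`
modulo `4` gives `D ≡ 2 (mod 4)`, and counting the `t` for which one of the two coprime factors is
divisible by the square of an odd prime shows that `D` is squarefree for arbitrarily large `t`
(`exists_squarefree_linear_pair`).
-/

/-! ### Second-order linear recurrences and their conjugates -/

/-- The sequence with `x₀ = a`, `x₁ = b` and `xₙ₊₂ = u xₙ₊₁ + xₙ`. -/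
def recSeq {R : Type*} [CommRing R] (u : ℕ) (a b : R) : ℕ → R
  | 0 => a
  | 1 => b
  | n + 2 => u * recSeq u a b (n + 1) + recSeq u a b n

section RecSeq

variable {R S : Type*} [CommRing R] [CommRing S] (u : ℕ) (a b : R)

@[simp] lemma recSeq_zero : recSeq u a b 0 = a := rfl

@[simp] lemma recSeq_one : recSeq u a b 1 = b := rfl

lemma recSeq_add_two (n : ℕ) :
    recSeq u a b (n + 2) = u * recSeq u a b (n + 1) + recSeq u a b n := rfl

lemma map_recSeq (f : R →+* S) (n : ℕ) :
    f (recSeq u a b n) = recSeq u (f a) (f b) n := by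
  induction n using Nat.twoStepInduction with
  | zero => rfl
  | one => rfl
  | more n h0 h1 => simp [recSeq_add_two, h0, h1]

lemma recSeq_add (n s : ℕ) :
    recSeq u a b (n + s + 1) =
      recSeq u 0 1 (s + 1) * recSeq u a b (n + 1) + recSeq u 0 1 s * recSeq u a b n := by
  induction s using Nat.twoStepInduction with
  | zero => simp
  | one => simp [recSeq_add_two]
  | more s h0 h1 =>
    rw [show n + (s + 2) + 1 = (n + s + 1) + 2 by ring, recSeq_add_two,
      show n + s + 1 + 1 = n + (s + 1) + 1 by ring, h0, h1, recSeq_add_two, recSeq_add_two]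
    simp only [recSeq_add_two]
    ring

/-- The form `x² + uxy - y²` changes sign from one pair of consecutive terms to the next. -/
lemma recSeq_norm (n : ℕ) :
    recSeq u a b n ^ 2 + u * recSeq u a b n * recSeq u a b (n + 1) - recSeq u a b (n + 1) ^ 2 =
      (-1) ^ n * (a ^ 2 + u * a * b - b ^ 2) := by
  induction n with
  | zero => simp
  | succ n ih =>
    rw [pow_succ (-1 : R), mul_neg_one, neg_mul, ← ih, recSeq_add_two]
    ring

/-- A Catalan-type identity, comparing the product of two terms at even distance with the square
of the term halfway between them. -/
lemma recSeq_mul_sub_sq (n s : ℕ) :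
    recSeq u a b n * recSeq u a b (n + 2 * (s + 1)) - recSeq u a b (n + s + 1) ^ 2 =
      (-1) ^ n * recSeq u 0 1 (s + 1) ^ 2 * (a ^ 2 + u * a * b - b ^ 2) := by
  have h := recSeq_norm u a b n
  have e1 : recSeq u a b (n + 2 * (s + 1)) =
      recSeq u 0 1 (s + 1) * recSeq u a b (n + s + 1 + 1) +
        recSeq u 0 1 s * recSeq u a b (n + s + 1) := by
    rw [← recSeq_add]; congr 1; ring
  have e2 : recSeq u a b (n + s + 1 + 1) =
      recSeq u 0 1 (s + 2) * recSeq u a b (n + 1) + recSeq u 0 1 (s + 1) * recSeq u a b n :=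
    recSeq_add u a b n (s + 1)
  rw [e1, e2, recSeq_add u a b n s, recSeq_add_two u (0 : R) 1 s]
  linear_combination recSeq u 0 1 (s + 1) ^ 2 * h

end RecSeq

/-- Any two consecutive terms of the sequence starting with `1, k + ω` span `ℤ + ℤω` over `ℤ`. -/
lemma recSeq_combination {R : Type*} [CommRing R] (u k : ℕ) (ω : R) (x y : ℤ) (n : ℕ) :
    ∃ c d : ℤ, (x + y * ω : R) =
      c * recSeq u 1 (k + ω) (n + 1) + d * recSeq u 1 (k + ω) n := by
  induction n with
  | zero =>
    refine ⟨y, x - y * k, ?_⟩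
    simp
    ring
  | succ n ih =>
    obtain ⟨c, d, h⟩ := ih
    refine ⟨d, c - d * u, ?_⟩
    rw [h, recSeq_add_two]
    push_cast
    ring

section Order

variable {R : Type*} [CommRing R] [LinearOrder R] [IsStrictOrderedRing R] {u : ℕ} {a b : R}

lemma recSeq_pos_and_lt (hu : 1 ≤ u) (ha : 0 < a) (hab : a < b) (n : ℕ) :
    0 < recSeq u a b n ∧ recSeq u a b n < recSeq u a b (n + 1) := by
  induction n with
  | zero => exact ⟨ha, hab⟩
  | succ n ih =>
    have hu' : (1 : R) ≤ u := by exact_mod_cast hu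
    have := ih.1.trans ih.2
    refine ⟨this, ?_⟩
    rw [recSeq_add_two]
    nlinarith [mul_le_mul_of_nonneg_right hu' this.le]

lemma recSeq_zero_one_pos (hu : 1 ≤ u) (n : ℕ) : 0 < recSeq u (0 : R) 1 (n + 1) := by
  have hu' : (1 : R) ≤ u := by exact_mod_cast hu
  induction n using Nat.twoStepInduction with
  | zero => simp
  | one => simp [recSeq_add_two]; linarith
  | more n h0 h1 =>
    rw [recSeq_add_two]
    nlinarith [mul_le_mul_of_nonneg_right hu' h1.le]

lemma recSeq_mul_lt_sq (hu : 1 ≤ u) (h : a ^ 2 + u * a * b - b ^ 2 < 0) {n : ℕ} (hn : Even n)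
    (s : ℕ) :
    recSeq u a b n * recSeq u a b (n + 2 * (s + 1)) < recSeq u a b (n + s + 1) ^ 2 := by
  have h1 := recSeq_mul_sub_sq u a b n s
  rw [hn.neg_one_pow, one_mul] at h1
  have h2 : (0 : R) < recSeq u 0 1 (s + 1) ^ 2 := pow_pos (recSeq_zero_one_pos hu s) 2
  nlinarith [mul_neg_of_pos_of_neg h2 h]

end Order

/-- If `c` and `d` have the same sign there is no cancellation in `c w + d w'`, and otherwise there
is none in `c r - d r'`. -/
lemma int_eq_zero_of_small {w w' r r' : ℝ} (hw : 0 < w) (hw' : 0 < w') (hr : 0 < r) (hrr : r ≤ r')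
    {c d : ℤ} (h1 : (c * w + d * w') ^ 2 < w ^ 2) (h2 : (c * r - d * r') ^ 2 < r ^ 2) :
    c = 0 ∧ d = 0 := by
  rw [sq_lt_sq, abs_of_pos hw, abs_lt] at h1
  rw [sq_lt_sq, abs_of_pos hr, abs_lt] at h2
  have key : ∀ {x : ℝ} {z : ℤ}, 0 < x → 1 ≤ z → x ≤ z * x := fun {x z} hx hz => by
    have : (1 : ℝ) ≤ z := by exact_mod_cast hz
    nlinarith
  have key0 : ∀ {x : ℝ} {z : ℤ}, 0 < x → 0 ≤ z → 0 ≤ z * x := fun {x z} hx hz => by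
    have : (0 : ℝ) ≤ z := by exact_mod_cast hz
    positivity
  have hr' := hr.trans_le hrr
  have neg : ∀ (z : ℤ) (x : ℝ), ((-z : ℤ) : ℝ) * x = -(z * x) := fun z x => by push_cast; ring
  rcases lt_trichotomy c 0 with hc | rfl | hc
  · exfalso
    rcases le_total d 0 with hd | hd
    · have a1 := key hw (show 1 ≤ -c by lia)
      have a2 := key0 hw' (show 0 ≤ -d by lia)
      rw [neg] at a1 a2
      linarith
    · have a1 := key hr (show 1 ≤ -c by lia)
      have a2 := key0 hr' hd
      rw [neg] at a1
      linarith
  · refine ⟨rfl, ?_⟩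
    by_contra hd
    rcases lt_or_gt_of_ne hd with hd | hd
    · have a1 := key hr' (show 1 ≤ -d by lia)
      rw [neg] at a1
      simp at h2
      linarith
    · have a1 := key hr' (show 1 ≤ d by lia)
      simp at h2
      linarith
  · exfalso
    rcases le_total d 0 with hd | hd
    · have a1 := key hr (show 1 ≤ c by lia)
      have a2 := key0 hr' (show 0 ≤ -d by lia)
      rw [neg] at a2
      linarith
    · have a1 := key hw (show 1 ≤ c by lia)
      have a2 := key0 hw' hd
      linarith

/-- Up to sign, replacing `ω` by `-ω` reverses the sequence and rescales it. -/
lemma recSeq_conj {u k ℓ : ℕ} {ω : ℝ}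
    (h : recSeq u 1 (k + ω) (ℓ + 1) * (ω - k) = recSeq u 1 (k + ω) ℓ) (n t : ℕ)
    (hnt : n + t = ℓ + 1) :
    recSeq u 1 (k - ω) n * recSeq u 1 (k + ω) (ℓ + 1) = (-1) ^ n * recSeq u 1 (k + ω) t := by
  induction n using Nat.twoStepInduction generalizing t with
  | zero => simp_all
  | one =>
    obtain rfl : t = ℓ := by lia
    simp
    linarith
  | more n h0 h1 =>
    have e1 := h1 (t + 1) (by lia)
    have e0 := h0 (t + 2) (by lia)
    rw [recSeq_add_two, add_mul, mul_assoc, e1, e0, recSeq_add_two]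
    ring

lemma recSeq_conj_pos {u k ℓ : ℕ} {ω : ℝ} (hu : 1 ≤ u) (hk : 1 ≤ k) (hω : 0 < ω)
    (h : recSeq u 1 (k + ω) (ℓ + 1) * (ω - k) = recSeq u 1 (k + ω) ℓ) {n : ℕ}
    (hn : n ≤ ℓ + 1) (hn2 : Even n) : 0 < recSeq u 1 (k - ω) n := by
  have hk' : (1 : ℝ) ≤ k := by exact_mod_cast hk
  have hW := fun m => (recSeq_pos_and_lt hu one_pos (show (1 : ℝ) < k + ω by linarith) m).1
  have := recSeq_conj h n (ℓ + 1 - n) (by lia)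
  rw [hn2.neg_one_pow, one_mul] at this
  exact pos_of_mul_pos_left (this ▸ hW _) (hW _).le

/-- With `Wₙ = recSeq u 1 (k + ω) n`, an integer whose square is at most `Wₙ Wₙ₊₂₍ₛ₊₁₎` in both
embeddings is zero. It is written in the basis formed by the middle term `Wₙ₊ₛ₊₁` and its
predecessor. -/
lemma eq_zero_of_sq_le_recSeq_mul {u k ℓ : ℕ} {ω : ℝ} (hu : 1 ≤ u) (hk : u + 1 ≤ k) (hω : 0 < ω)
    (h : recSeq u 1 (k + ω) (ℓ + 1) * (ω - k) = recSeq u 1 (k + ω) ℓ) {n s t : ℕ}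
    (hn : Even n) (ht : Even t) (hℓ : n + 2 * (s + 1) + t = ℓ + 1) (c d : ℤ)
    (h1 : (c * recSeq u 1 (k + ω) (n + s + 1) + d * recSeq u 1 (k + ω) (n + s)) ^ 2 ≤
      recSeq u 1 (k + ω) n * recSeq u 1 (k + ω) (n + 2 * (s + 1)))
    (h2 : (c * recSeq u 1 (k - ω) (n + s + 1) + d * recSeq u 1 (k - ω) (n + s)) ^ 2 ≤
      recSeq u 1 (k - ω) n * recSeq u 1 (k - ω) (n + 2 * (s + 1))) :
    c = 0 ∧ d = 0 := by
  have hu' : (1 : ℝ) ≤ u := by exact_mod_cast hu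
  have hk' : (u : ℝ) + 1 ≤ k := by exact_mod_cast hk
  have hW := fun m => recSeq_pos_and_lt hu one_pos (show (1 : ℝ) < k + ω by linarith) m
  have hneg : (1 : ℝ) ^ 2 + u * 1 * (k + ω) - (k + ω) ^ 2 < 0 := by nlinarith
  have hP := (hW (ℓ + 1)).1
  have c1 := recSeq_conj h (n + s + 1) (t + s + 1) (by lia)
  have c2 := recSeq_conj h (n + s) (t + s + 2) (by lia)
  have c3 := recSeq_conj h n (t + 2 * (s + 1)) (by lia)
  have c4 := recSeq_conj h (n + 2 * (s + 1)) t (by lia)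
  rw [hn.neg_one_pow] at c3
  rw [(hn.add (even_two_mul _)).neg_one_pow] at c4
  refine int_eq_zero_of_small (hW _).1 (hW (n + s)).1 (hW (t + s + 1)).1 (hW (t + s + 1)).2.le
    (h1.trans_lt (recSeq_mul_lt_sq hu hneg hn s)) (lt_of_le_of_lt ?_
      (recSeq_mul_lt_sq hu hneg ht s))
  have h3 := mul_le_mul_of_nonneg_right h2 (sq_nonneg (recSeq u 1 (k + ω) (ℓ + 1)))
  calc _ = ((c * recSeq u 1 (k - ω) (n + s + 1) + d * recSeq u 1 (k - ω) (n + s)) *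
        recSeq u 1 (k + ω) (ℓ + 1)) ^ 2 := by
        rw [add_mul, mul_assoc, c1, mul_assoc, c2]
        rw [pow_succ (-1 : ℝ) (n + s)]
        have : ((-1 : ℝ) ^ (n + s)) ^ 2 = 1 := by rw [← pow_mul, mul_comm, pow_mul]; simp
        linear_combination (-(c * recSeq u 1 (k + ω) (t + s + 1) -
          d * recSeq u 1 (k + ω) (t + s + 2)) ^ 2) * this
    _ ≤ recSeq u 1 (k - ω) n * recSeq u 1 (k - ω) (n + 2 * (s + 1)) *
        recSeq u 1 (k + ω) (ℓ + 1) ^ 2 := by rw [mul_pow]; exact h3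
    _ = (recSeq u 1 (k - ω) n * recSeq u 1 (k + ω) (ℓ + 1)) *
        (recSeq u 1 (k - ω) (n + 2 * (s + 1)) * recSeq u 1 (k + ω) (ℓ + 1)) := by ring
    _ = _ := by rw [c3, c4]; ring

/-! ### Simultaneous squarefree values of two linear polynomials -/

lemma sum_inv_odd_sq_le (J : ℕ) :
    ∑ j ∈ Finset.range J, (1 : ℝ) / (2 * (j : ℝ) + 3) ^ 2 ≤ 1 / 4 := by
  suffices h : ∑ j ∈ Finset.range J, (1 : ℝ) / (2 * (j : ℝ) + 3) ^ 2 ≤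
      1 / 4 * (1 - 1 / ((J : ℝ) + 1)) by
    have : (0 : ℝ) ≤ 1 / (J + 1) := by positivity
    linarith
  induction J with
  | zero => simp
  | succ J ih =>
    rw [Finset.sum_range_succ]
    have : (1 : ℝ) / (2 * J + 3) ^ 2 ≤ 1 / 4 * (1 / (J + 1) - 1 / (J + 1 + 1)) := by
      have hJ : (0 : ℝ) ≤ J := by positivity
      rw [div_sub_div _ _ (by positivity) (by positivity), ← mul_div_assoc,
        div_le_div_iff₀ (by positivity) (by positivity)]
      nlinarith
    push_cast
    linarith

lemma card_sq_dvd_le (A B N p : ℕ) (hp : p.Prime) (h : p ∣ A → ¬ p ∣ B) :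
    (((Finset.range N).filter fun n => p ^ 2 ∣ A * n + B).card : ℝ) ≤ N / (p : ℝ) ^ 2 + 1 := by
  have hp2 : 0 < p ^ 2 := pow_pos hp.pos 2
  rcases ((Finset.range N).filter fun n => p ^ 2 ∣ A * n + B).eq_empty_or_nonempty with h0 | ⟨v, hv⟩
  · rw [h0]; simp; positivity
  simp only [Finset.mem_filter, Finset.mem_range] at hv
  have hpA : (p ^ 2).Coprime A := by
    refine Nat.Coprime.pow_left 2 ((Nat.Prime.coprime_iff_not_dvd hp).2 fun hA => ?_)
    have hB : p ∣ B := (Nat.dvd_add_right (hA.mul_right v)).1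
      ((dvd_pow_self p two_ne_zero).trans hv.2)
    exact h hA hB
  have hsub : ((Finset.range N).filter fun n => p ^ 2 ∣ A * n + B) ⊆
      (Finset.range N).filter fun n => n ≡ v [MOD p ^ 2] := by
    intro n hn
    simp only [Finset.mem_filter, Finset.mem_range] at hn ⊢
    refine ⟨hn.1, ?_⟩
    have h1 : A * n + B ≡ A * v + B [MOD p ^ 2] :=
      (Nat.modEq_zero_iff_dvd.2 hn.2).trans (Nat.modEq_zero_iff_dvd.2 hv.2).symm
    exact Nat.ModEq.cancel_left_of_coprime hpA (Nat.ModEq.add_right_cancel' B h1)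
  have h2 := Finset.card_le_card hsub
  rw [← Nat.count_eq_card_filter_range, ← Nat.count_eq_card_filter_range,
    Nat.count_modEq_card N hp2 v] at h2
  have h3 : N.count (fun n => p ^ 2 ∣ A * n + B) ≤ N / p ^ 2 + 1 := by
    refine h2.trans ?_
    gcongr
    split_ifs <;> simp
  rw [← Nat.count_eq_card_filter_range]
  calc ((N.count fun n => p ^ 2 ∣ A * n + B : ℕ) : ℝ) ≤ ((N / p ^ 2 + 1 : ℕ) : ℝ) := by
        exact_mod_cast h3
    _ ≤ _ := by
        push_cast
        have := @Nat.cast_div_le ℝ _ _ _ N (p ^ 2)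
        push_cast at this
        linarith

/-- Two linear polynomials, each without a fixed odd prime divisor and never divisible by `4`, take
squarefree values simultaneously. -/
lemma exists_squarefree_linear_pair (A₁ B₁ A₂ B₂ : ℕ) (hB₁ : 0 < B₁) (hB₂ : 0 < B₂)
    (h₁ : ∀ p, p.Prime → p ∣ A₁ → p ∣ B₁ → p = 2) (h₂ : ∀ p, p.Prime → p ∣ A₂ → p ∣ B₂ → p = 2)
    (h4₁ : ∀ n, ¬ 4 ∣ A₁ * n + B₁) (h4₂ : ∀ n, ¬ 4 ∣ A₂ * n + B₂) :
    ∃ n, Squarefree (A₁ * n + B₁) ∧ Squarefree (A₂ * n + B₂) := by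
  obtain ⟨A, hA⟩ : ∃ A, A = A₁ + B₁ + A₂ + B₂ := ⟨_, rfl⟩
  -- All values are at most `A N = (4 A)²`, so only primes up to `4 A` matter, and the at most
  -- `2 (N / 4 + 2 A) = 12 A` excluded arguments do not exhaust the `N = 16 A` available ones.
  let N := 16 * A
  let J := 2 * A
  let S : ℕ → ℕ → ℕ → Finset ℕ := fun a b j =>
    (Finset.range N).filter fun n => (2 * j + 3).Prime ∧ (2 * j + 3) ^ 2 ∣ a * n + b
  have hS : ∀ a b, (∀ p, p.Prime → p ∣ a → p ∣ b → p = 2) →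
      (((Finset.range J).biUnion (S a b)).card : ℝ) ≤ 6 * A := by
    intro a b hab
    calc (((Finset.range J).biUnion (S a b)).card : ℝ)
        ≤ ((∑ j ∈ Finset.range J, (S a b j).card : ℕ) : ℝ) := by
          exact_mod_cast Finset.card_biUnion_le
      _ = ∑ j ∈ Finset.range J, ((S a b j).card : ℝ) := by push_cast; rfl
      _ ≤ ∑ j ∈ Finset.range J, (N * ((1 : ℝ) / (2 * (j : ℝ) + 3) ^ 2) + 1) := by
          refine Finset.sum_le_sum fun j _ => ?_
          by_cases hj : (2 * j + 3).Prime
          · have := card_sq_dvd_le a b N (2 * j + 3) hj fun ha hb => by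
              have := hab _ hj ha hb
              lia
            simp only [S, hj, true_and]
            push_cast at this
            rw [mul_one_div]
            exact this
          · simp only [S, hj, false_and, Finset.filter_false, Finset.card_empty,
              Nat.cast_zero]
            positivity
      _ = N * ∑ j ∈ Finset.range J, ((1 : ℝ) / (2 * (j : ℝ) + 3) ^ 2) + J := by
          rw [Finset.sum_add_distrib, ← Finset.mul_sum]; simp
      _ ≤ N * (1 / 4) + J := by gcongr; exact sum_inv_odd_sq_le J
      _ = 6 * A := by simp only [N, J]; push_cast; ring
  have hA0 : 0 < A := by lia
  have hcard : ((Finset.range J).biUnion (S A₁ B₁) ∪ (Finset.range J).biUnion (S A₂ B₂)).card <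
      (Finset.range N).card := by
    have h := Finset.card_union_le ((Finset.range J).biUnion (S A₁ B₁))
      ((Finset.range J).biUnion (S A₂ B₂))
    have e1 : ((Finset.range J).biUnion (S A₁ B₁)).card ≤ 6 * A := by exact_mod_cast hS _ _ h₁
    have e2 : ((Finset.range J).biUnion (S A₂ B₂)).card ≤ 6 * A := by exact_mod_cast hS _ _ h₂
    rw [Finset.card_range]
    simp only [N]
    lia
  obtain ⟨n, hnN, hn⟩ := Finset.exists_mem_notMem_of_card_lt_card hcard
  have hsq : ∀ a b, 0 < b → a + b ≤ A → (∀ n, ¬ 4 ∣ a * n + b) →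
      n ∉ (Finset.range J).biUnion (S a b) → Squarefree (a * n + b) := by
    intro a b hb hab h4 hn'
    rw [Nat.squarefree_iff_prime_squarefree]
    intro p hp hdvd
    rcases hp.eq_two_or_odd' with rfl | ⟨i, rfl⟩
    · exact h4 n hdvd
    have hi : i ≠ 0 := by rintro rfl; exact Nat.not_prime_one hp
    obtain ⟨j, rfl⟩ := Nat.exists_eq_succ_of_ne_zero hi
    have hnN' : n < 16 * A := Finset.mem_range.1 hnN
    have hle : (2 * (j + 1) + 1) * (2 * (j + 1) + 1) ≤ (4 * A) * (4 * A) := by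
      have h1 := Nat.le_of_dvd (by lia) hdvd
      have h2 : a * n + b ≤ (a + b) * (16 * A) := by nlinarith
      have h3 := Nat.mul_le_mul_right (16 * A) hab
      calc _ ≤ _ := h1
        _ ≤ _ := h2.trans h3
        _ = _ := by ring
    have hle' := Nat.mul_self_le_mul_self_iff.1 hle
    refine hn' (Finset.mem_biUnion.2 ⟨j, Finset.mem_range.2 (by simp only [J]; lia), ?_⟩)
    simp only [S, Finset.mem_filter]
    exact ⟨hnN, by convert hp using 1; lia, by
      convert hdvd using 1; rw [Nat.succ_eq_add_one]; ring⟩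
  simp only [Finset.mem_union, not_or] at hn
  exact ⟨n, hsq _ _ hB₁ (by lia) h4₁ hn.1, hsq _ _ hB₂ (by lia) h4₂ hn.2⟩

/-! ### Continued fraction expansions -/

/-- A sequence of complete quotients `ξₙ = aₙ + 1 / ξₙ₊₁` with `ξₙ₊₁ > 1` determines the continued
fraction expansion of `ξ₀`. -/
lemma genContFract_of_completeQuotients (ξ : ℕ → ℝ) (a : ℕ → ℤ) (h1 : ∀ n, 1 < ξ (n + 1))
    (h : ∀ n, ξ n = a n + (ξ (n + 1))⁻¹) :
    (GenContFract.of (ξ 0)).h = a 0 ∧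
      ∀ n, (GenContFract.of (ξ 0)).partDens.get? n = some (a (n + 1) : ℝ) := by
  have hfl : ∀ n, ⌊ξ n⌋ = a n := fun n => by
    have := h1 n
    rw [h n, Int.floor_intCast_add, Int.floor_eq_zero_iff.2, add_zero]
    exact ⟨by positivity, inv_lt_one_of_one_lt₀ this⟩
  have hfr : ∀ n, (Int.fract (ξ n))⁻¹ = ξ (n + 1) := fun n => by
    have : Int.fract (ξ n) = (ξ (n + 1))⁻¹ := by rw [Int.fract, hfl, h n]; ring
    rw [this, inv_inv]
  refine ⟨by rw [GenContFract.of_h_eq_floor, hfl], fun n => ?_⟩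
  have key : ∀ n i, (GenContFract.of (ξ i)).s.get? n = some ⟨1, a (i + n + 1)⟩ := by
    intro n
    induction n with
    | zero =>
      intro i
      have h0 : Int.fract (ξ i) ≠ 0 := fun h0 => by
        have := hfr i
        rw [h0, inv_zero] at this
        linarith [h1 i]
      have := GenContFract.of_s_head h0
      rw [hfr, hfl] at this
      exact this
    | succ n ih =>
      intro i
      rw [GenContFract.of_s_succ, hfr, ih]
      congr 3
      ring_nf
  rw [GenContFract.partDen_eq_s_b (key n 0)]
  simp

lemma hasPeriodicExpansion_of_recSeq {u k ℓ : ℕ} {ω : ℝ} (hu : 1 ≤ u) (hk : 1 ≤ k) (hω : 0 < ω)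
    (h : recSeq u 1 (k + ω) (ℓ + 1) * (ω - k) = recSeq u 1 (k + ω) ℓ) :
    HasPeriodicExpansion ω k u ℓ := by
  have hk' : (1 : ℝ) ≤ k := by exact_mod_cast hk
  have hW := fun m => recSeq_pos_and_lt hu one_pos (show (1 : ℝ) < k + ω by linarith) m
  -- `η j` is the complete quotient preceding the end of the period by `j` steps.
  let η : ℕ → ℝ := fun j => recSeq u 1 (k + ω) (j + 1) / recSeq u 1 (k + ω) j
  have hη : ∀ j, 1 < η j := fun j => (one_lt_div (hW j).1).2 (hW j).2
  have hη_succ : ∀ j, η (j + 1) = u + (η j)⁻¹ := fun j => by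
    have := (hW j).1
    have := (hW (j + 1)).1
    simp only [η, recSeq_add_two, inv_div]
    field_simp
  have hη_last : ω = k + (η ℓ)⁻¹ := by
    have := (hW (ℓ + 1)).1
    simp only [η, inv_div, ← h]
    field_simp
    ring
  have hη_zero : η 0 = k + ω := by simp [η]
  let ξ : ℕ → ℝ
    | 0 => ω
    | n + 1 => η (ℓ - n % (ℓ + 1))
  let a : ℕ → ℤ
    | 0 => k
    | n + 1 => if n % (ℓ + 1) = ℓ then 2 * k else u
  have hξ : ∀ n, ξ n = Int.cast (a n) + (ξ (n + 1))⁻¹ := by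
    intro n
    cases n with
    | zero => simpa [ξ, a] using hη_last
    | succ n =>
      simp only [ξ, a]
      have hlt : n % (ℓ + 1) < ℓ + 1 := Nat.mod_lt _ (by lia)
      by_cases hn : n % (ℓ + 1) = ℓ
      · have : (n + 1) % (ℓ + 1) = 0 := by rw [Nat.add_mod, hn]; simp
        rw [if_pos hn, this, hn, Nat.sub_self, Nat.sub_zero, hη_zero]
        push_cast
        linarith
      · have : (n + 1) % (ℓ + 1) = n % (ℓ + 1) + 1 := by
          rw [Nat.add_mod, Nat.mod_eq_of_lt (a := n % (ℓ + 1) + 1 % (ℓ + 1))]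
          · rw [Nat.mod_eq_of_lt (a := 1)]; lia
          · rw [Nat.mod_eq_of_lt (a := 1)] <;> lia
        rw [if_neg hn, this, show ℓ - n % (ℓ + 1) = (ℓ - (n % (ℓ + 1) + 1)) + 1 by lia, hη_succ]
        push_cast
        rfl
  obtain ⟨e1, e2⟩ := genContFract_of_completeQuotients ξ a (fun n => hη _) hξ
  refine ⟨by simpa [ξ, a] using e1, fun n => ?_⟩
  rw [show ω = ξ 0 from rfl, e2 n]
  simp only [a]
  split_ifs <;> simp

/-! ### The fields generated by square roots -/

section QuadraticField

variable {D : ℕ}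

lemma not_isSquare_of_mod_four (hD : D % 4 = 2) : ¬ IsSquare D := by
  rintro ⟨n, rfl⟩
  rcases Nat.even_or_odd' n with ⟨m, rfl | rfl⟩ <;> ring_nf at hD <;> lia

lemma irreducible_X_sq_sub (hD : ¬ IsSquare D) :
    Irreducible (Polynomial.X ^ 2 - Polynomial.C (D : ℚ)) := by
  refine X_pow_sub_C_irreducible_of_prime Nat.prime_two fun b hb => hD ?_
  have : IsSquare (D : ℚ) := ⟨b, by rw [← hb, sq]⟩
  exact_mod_cast Rat.isSquare_natCast_iff.1 this

lemma minpoly_sqrt_natCast (hD : ¬ IsSquare D) :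
    minpoly ℚ √(D : ℝ) = Polynomial.X ^ 2 - Polynomial.C (D : ℚ) := by
  refine (minpoly.eq_of_irreducible_of_monic (irreducible_X_sq_sub hD) ?_
    (Polynomial.monic_X_pow_sub_C _ two_ne_zero)).symm
  simp

lemma isIntegral_sqrt_natCast (R : Type*) [CommRing R] [Algebra R ℝ] (D : ℕ) :
    IsIntegral R √(D : ℝ) := by
  refine ⟨Polynomial.X ^ 2 - Polynomial.C (D : R), Polynomial.monic_X_pow_sub_C _ two_ne_zero, ?_⟩
  simp

lemma finrank_adjoin_sqrt (hD : ¬ IsSquare D) : Module.finrank ℚ ℚ⟮√(D : ℝ)⟯ = 2 := by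
  rw [IntermediateField.adjoin.finrank (isIntegral_sqrt_natCast ℚ D), minpoly_sqrt_natCast hD,
    Polynomial.natDegree_X_pow_sub_C]

lemma exists_conj_adjoin_sqrt (hD : ¬ IsSquare D) :
    ∃ τ : ℚ⟮√(D : ℝ)⟯ →ₐ[ℚ] ℝ, τ (IntermediateField.AdjoinSimple.gen ℚ √(D : ℝ)) = -√(D : ℝ) := by
  have hint := isIntegral_sqrt_natCast ℚ D
  have hmem : -√(D : ℝ) ∈ (minpoly ℚ √(D : ℝ)).aroots ℝ := by
    rw [Polynomial.mem_aroots]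
    refine ⟨minpoly.ne_zero hint, ?_⟩
    rw [minpoly_sqrt_natCast hD]
    simp
  exact ⟨_, IntermediateField.algHomAdjoinIntegralEquiv_symm_apply_gen ℚ hint ⟨_, hmem⟩⟩

lemma exists_rat_coords {x : ℝ} (hx : x ∈ ℚ⟮√(D : ℝ)⟯) :
    ∃ r s : ℚ, x = r + s * √(D : ℝ) := by
  have hx' : x ∈ Algebra.adjoin ℚ {√(D : ℝ)} := by
    rwa [← IntermediateField.adjoin_simple_toSubalgebra_of_isAlgebraic
      (isIntegral_sqrt_natCast ℚ D).isAlgebraic]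
  clear hx
  induction hx' using Algebra.adjoin_induction with
  | mem x h =>
    obtain rfl : x = _ := h
    exact ⟨0, 1, by simp⟩
  | algebraMap r => exact ⟨r, 0, by simp⟩
  | add x y hx hy h1 h2 =>
    obtain ⟨a, b, rfl⟩ := h1
    obtain ⟨c, d, rfl⟩ := h2
    exact ⟨a + c, b + d, by push_cast; ring⟩
  | mul x y hx hy h1 h2 =>
    obtain ⟨a, b, rfl⟩ := h1
    obtain ⟨c, d, rfl⟩ := h2
    refine ⟨a * c + b * d * D, a * d + b * c, ?_⟩
    have := Real.mul_self_sqrt (Nat.cast_nonneg (α := ℝ) D)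
    push_cast
    linear_combination (b * d : ℝ) * this

lemma exists_int_of_isIntegral {q : ℚ} (h : IsIntegral ℤ (q : ℝ)) : ∃ n : ℤ, (n : ℚ) = q := by
  have h' : IsIntegral ℤ q := by
    rw [← eq_ratCast (algebraMap ℚ ℝ)] at h
    exact (isIntegral_algebraMap_iff (algebraMap ℚ ℝ).injective).1 h
  exact IsIntegrallyClosed.isIntegral_iff.1 h'

/-- Since `D ≡ 2 (mod 4)` is squarefree, an element of `ℚ(√D)` integral over `ℤ` together with its
conjugate has integral coordinates. -/
lemma exists_int_coords (hsq : Squarefree D) (hD : D % 4 = 2) {r s : ℚ}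
    (h₁ : IsIntegral ℤ (r + s * √(D : ℝ))) (h₂ : IsIntegral ℤ (r - s * √(D : ℝ))) :
    ∃ a b : ℤ, r = a ∧ s = b := by
  have hω := Real.mul_self_sqrt (Nat.cast_nonneg (α := ℝ) D)
  obtain ⟨n, hn⟩ := exists_int_of_isIntegral (q := 2 * r) (by
    have e : ((2 * r : ℚ) : ℝ) = (r + s * √(D : ℝ)) + (r - s * √(D : ℝ)) := by push_cast; ring
    rw [e]
    exact h₁.add h₂)
  obtain ⟨m, hm⟩ := exists_int_of_isIntegral (q := r ^ 2 - D * s ^ 2) (by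
    have e : ((r ^ 2 - D * s ^ 2 : ℚ) : ℝ) = (r + s * √(D : ℝ)) * (r - s * √(D : ℝ)) := by
      push_cast
      linear_combination (s ^ 2 : ℝ) * hω
    rw [e]
    exact h₁.mul h₂)
  have hD0 : (D : ℚ) ≠ 0 := by
    have : D ≠ 0 := by rintro rfl; simp at hD
    exact_mod_cast this
  -- `D (2 s)²` is integral, so `D ∣ (D · 2 s)²`, and `2 s` is integral because `D` is squarefree.
  obtain ⟨f, hf⟩ : ∃ f : ℤ, (f : ℚ) = D * (2 * s) := by
    refine IsIntegrallyClosed.isIntegral_iff.1 (IsIntegral.of_pow two_pos ?_)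
    have : ((D : ℚ) * (2 * s)) ^ 2 = algebraMap ℤ ℚ (D * (n ^ 2 - 4 * m)) := by
      simp only [eq_intCast]
      push_cast
      rw [hn, hm]
      ring
    rw [this]
    exact isIntegral_algebraMap
  have hf2 : (f ^ 2 : ℤ) = D * (n ^ 2 - 4 * m) := by
    have : (f ^ 2 : ℚ) = D * (n ^ 2 - 4 * m) := by rw [hf, hn, hm]; ring
    exact_mod_cast this
  have hdvd : (D : ℤ) ∣ f :=
    ((Int.squarefree_natCast.2 hsq).dvd_pow_iff_dvd two_ne_zero).1 ⟨_, hf2⟩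
  obtain ⟨g, rfl⟩ := hdvd
  have hg : (g : ℚ) = 2 * s := by
    push_cast at hf
    exact mul_left_cancel₀ hD0 hf
  have key : n ^ 2 - D * g ^ 2 = 4 * m := by
    have : (n ^ 2 - D * g ^ 2 : ℚ) = 4 * m := by rw [hn, hm, hg]; ring
    exact_mod_cast this
  obtain ⟨D', hD'⟩ : ∃ D' : ℤ, (D : ℤ) = 4 * D' + 2 := ⟨D / 4, by lia⟩
  rw [hD'] at key
  rcases Int.even_or_odd' n with ⟨a, rfl | rfl⟩ <;> rcases Int.even_or_odd' g with ⟨b, rfl | rfl⟩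
  · refine ⟨a, b, ?_, ?_⟩
    · push_cast at hn; linarith
    · push_cast at hg; linarith
  all_goals
    exfalso
    ring_nf at key
    lia

/-- The ring of integers of `ℚ(√D)` is `ℤ[θ]` with `θ = √D`, and the field has a second real
embedding `τ`, which sends `θ` to `-√D`. -/
lemma exists_sqrt_basis (hsq : Squarefree D) (hD : D % 4 = 2) :
    ∃ (θ : 𝓞 ℚ⟮√(D : ℝ)⟯) (τ : ℚ⟮√(D : ℝ)⟯ →+* ℝ),
      algebraMap ℚ⟮√(D : ℝ)⟯ ℝ θ = √(D : ℝ) ∧ τ θ = -√(D : ℝ) ∧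
        ∀ x : 𝓞 ℚ⟮√(D : ℝ)⟯, ∃ a b : ℤ, x = a + b * θ := by
  have hns := not_isSquare_of_mod_four hD
  obtain ⟨τ, hτ⟩ := exists_conj_adjoin_sqrt hns
  let g := IntermediateField.AdjoinSimple.gen ℚ √(D : ℝ)
  have hg : algebraMap ℚ⟮√(D : ℝ)⟯ ℝ g = √(D : ℝ) :=
    IntermediateField.AdjoinSimple.algebraMap_gen ℚ _
  have hgint : IsIntegral ℤ g := by
    have := isIntegral_sqrt_natCast ℤ D
    rw [← hg] at this
    exact (isIntegral_algebraMap_iff (algebraMap ℚ⟮√(D : ℝ)⟯ ℝ).injective).1 this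
  obtain ⟨θ, hθ⟩ : ∃ θ : 𝓞 ℚ⟮√(D : ℝ)⟯, (θ : ℚ⟮√(D : ℝ)⟯) = g := ⟨⟨g, hgint⟩, rfl⟩
  refine ⟨θ, τ, hθ ▸ hg, hθ ▸ hτ, fun x => ?_⟩
  obtain ⟨r, s, hrs⟩ := exists_rat_coords (x : ℚ⟮√(D : ℝ)⟯).2
  have hx : (x : ℚ⟮√(D : ℝ)⟯) = r + s * g := by
    apply (algebraMap ℚ⟮√(D : ℝ)⟯ ℝ).injective
    rw [map_add, map_mul, hg, map_ratCast, map_ratCast]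
    exact hrs
  have hxint : IsIntegral ℤ (x : ℚ⟮√(D : ℝ)⟯) := x.2
  have i1 := hxint.map (algebraMap ℚ⟮√(D : ℝ)⟯ ℝ).toIntAlgHom
  have i2 := hxint.map τ.toRingHom.toIntAlgHom
  have e1 : (algebraMap ℚ⟮√(D : ℝ)⟯ ℝ).toIntAlgHom (x : ℚ⟮√(D : ℝ)⟯) = r + s * √(D : ℝ) := hrs
  have e2 : τ.toRingHom.toIntAlgHom (x : ℚ⟮√(D : ℝ)⟯) = r - s * √(D : ℝ) := by
    change τ (x : ℚ⟮√(D : ℝ)⟯) = _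
    rw [hx, map_add, map_mul, hτ, map_ratCast, map_ratCast]
    ring
  rw [e1] at i1
  rw [e2] at i2
  obtain ⟨a, b, rfl, rfl⟩ := exists_int_coords hsq hD i1 i2
  refine ⟨a, b, ?_⟩
  apply NumberField.RingOfIntegers.ext
  rw [hx, ← hθ, Rat.cast_intCast, Rat.cast_intCast]
  simp

/-- Distinct squarefree radicands generate distinct fields. -/
lemma adjoin_sqrt_injOn :
    Set.InjOn (fun D : ℕ => ℚ⟮√(D : ℝ)⟯) {D | Squarefree D ∧ D % 4 = 2} := by
  rintro D ⟨hsq, hD⟩ E ⟨hsqE, hE⟩ h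
  have hmem : √(E : ℝ) ∈ ℚ⟮√(D : ℝ)⟯ := by
    rw [show ℚ⟮√(D : ℝ)⟯ = ℚ⟮√(E : ℝ)⟯ from h]
    exact IntermediateField.mem_adjoin_simple_self ℚ √(E : ℝ)
  obtain ⟨r, s, hrs⟩ := exists_rat_coords hmem
  have hirr : Irrational √(D : ℝ) := irrational_sqrt_natCast_iff.2 (not_isSquare_of_mod_four hD)
  have hirrE : Irrational √(E : ℝ) := irrational_sqrt_natCast_iff.2 (not_isSquare_of_mod_four hE)
  have hD2 := Real.mul_self_sqrt (Nat.cast_nonneg (α := ℝ) D)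
  have hE2 := Real.mul_self_sqrt (Nat.cast_nonneg (α := ℝ) E)
  have hs : s ≠ 0 := by
    rintro rfl
    exact hirrE ⟨r, by simpa using hrs.symm⟩
  have hr : r = 0 := by
    by_contra hr
    refine hirr ⟨(E - r ^ 2 - s ^ 2 * D) / (2 * r * s), ?_⟩
    have hr' : (r : ℝ) ≠ 0 := by exact_mod_cast hr
    have hs' : (s : ℝ) ≠ 0 := by exact_mod_cast hs
    push_cast
    rw [div_eq_iff (by positivity), ← hE2, hrs]
    linear_combination (s ^ 2 : ℝ) * hD2
  have hED : (E * D : ℚ) = (s * D) * (s * D) := by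
    have : (E * D : ℝ) = (s * D) * (s * D) := by
      rw [← hE2, hrs, hr]
      push_cast
      linear_combination (s ^ 2 * D : ℝ) * hD2
    exact_mod_cast this
  obtain ⟨n, hn⟩ : IsSquare (E * D) := by
    apply Rat.isSquare_natCast_iff.1
    exact ⟨s * D, by push_cast; exact hED⟩
  have dvd_of : ∀ {A B : ℕ}, Squarefree A → Squarefree B → A * B = n * n → A ∣ B := by
    intro A B hA hB hAB
    obtain ⟨c, rfl⟩ := (hA.dvd_pow_iff_dvd two_ne_zero).1 ⟨B, by rw [sq, hAB]⟩
    have h0 : A ≠ 0 := hA.ne_zero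
    exact ⟨c * c, Nat.eq_of_mul_eq_mul_left (Nat.pos_of_ne_zero h0) (by rw [hAB]; ring)⟩
  exact Nat.dvd_antisymm (dvd_of hsq hsqE (by rw [mul_comm, hn])) (dvd_of hsqE hsq hn)

end QuadraticField

/-! ### Orthogonality in classical totally positive forms -/

section Forms

variable {K : Type*} [Field K] {M : ℕ} {Q : QuadraticForm (𝓞 K) (Fin M → 𝓞 K)}

lemma IsClassical.two_dvd_polar (hQ : IsClassical Q) (v w : Fin M → 𝓞 K) :
    2 ∣ QuadraticMap.polar Q v w := by
  have hb : ∀ i j, 2 ∣ Q.polarBilin (Pi.single i 1) (Pi.single j 1) := by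
    intro i j
    rw [QuadraticMap.polarBilin_apply_apply]
    by_cases h : i = j
    · subst h
      exact ⟨Q (Pi.single i 1), by rw [QuadraticMap.polar_self]; simp⟩
    · exact hQ i j h
  rw [← QuadraticMap.polarBilin_apply_apply, pi_eq_sum_univ' v, pi_eq_sum_univ' w]
  simp only [map_sum, LinearMap.sum_apply, map_smul, LinearMap.smul_apply, smul_eq_mul,
    Finset.mul_sum]
  refine Finset.dvd_sum fun i _ => Finset.dvd_sum fun j _ => ?_
  have e : ∀ i : Fin M, (fun j => if i = j then (1 : 𝓞 K) else 0) = Pi.single i 1 := by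
    intro i
    ext j
    simp [Pi.single_apply, eq_comm]
  refine Dvd.dvd.mul_left (Dvd.dvd.mul_left ?_ _) _
  simpa [e] using hb j i

/-- The Cauchy–Schwarz inequality in every real embedding. -/
lemma IsTotallyPositiveForm.sq_le (hQ : IsTotallyPositiveForm Q) {v w : Fin M → 𝓞 K} (hw : w ≠ 0)
    {b : 𝓞 K} (hb : QuadraticMap.polar Q v w = 2 * b) (σ : K →+* ℝ) :
    σ b ^ 2 ≤ σ (Q v) * σ (Q w) := by
  have hpos := hQ w hw σ
  -- The projection of `v` off `w`, scaled to have integral coordinates.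
  have hval : Q (Q w • v + (-b) • w) = Q w * (Q v * Q w - b ^ 2) := by
    rw [QuadraticMap.map_add Q, QuadraticMap.map_smul, QuadraticMap.map_smul,
      QuadraticMap.polar_smul_left, QuadraticMap.polar_smul_right, hb]
    simp only [smul_eq_mul]
    ring
  have hnn : 0 ≤ σ (Q (Q w • v + (-b) • w)) := by
    by_cases h0 : Q w • v + (-b) • w = 0
    · rw [h0]; simp
    · exact (hQ _ h0 σ).le
  rw [hval] at hnn
  simp only [map_mul, map_sub, map_pow] at hnn
  have := nonneg_of_mul_nonneg_right hnn hpos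
  linarith

/-- An obstruction to universality in `M` variables: `M + 1` totally positive integers whose
representing vectors are forced to be pairwise orthogonal. -/
lemma not_admitsClassicalUniversalForm_of_family (σ₀ : K →+* ℝ) (α : Fin (M + 1) → 𝓞 K)
    (hα : ∀ i, TotallyPositive K (α i))
    (h : ∀ i j, i ≠ j → ∀ b : 𝓞 K,
      (∀ σ : K →+* ℝ, σ b ^ 2 ≤ σ (α i) * σ (α j)) → b = 0) :
    ¬ AdmitsClassicalUniversalForm K M := by
  rintro ⟨Q, hcl, hpos, huniv⟩
  choose v hv using fun i => huniv (α i) (hα i)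
  have hα0 : ∀ i, α i ≠ 0 := fun i h0 => by
    have := hα i σ₀
    simp [h0] at this
  have hv0 : ∀ i, v i ≠ 0 := fun i h0 => hα0 i (by rw [← hv, h0, QuadraticMap.map_zero])
  have : CharZero K := σ₀.charZero
  have horth : Q.polarBilin.IsOrthoᵢ v := by
    intro i j hij
    obtain ⟨b, hb⟩ := hcl.two_dvd_polar (v i) (v j)
    have hb0 : b = 0 := h i j hij b fun σ => by
      have := hpos.sq_le (hv0 j) hb σ
      rwa [hv, hv] at this
    change QuadraticMap.polar Q (v i) (v j) = 0
    rw [hb, hb0, mul_zero]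
  have hli : LinearIndependent (𝓞 K) v := by
    refine linearIndependent_iff'.2 fun s g hg i hi => ?_
    have h0 : Q.polarBilin (∑ j ∈ s, g j • v j) (v i) = 0 := by rw [hg]; simp
    rw [map_sum, LinearMap.sum_apply, Finset.sum_eq_single_of_mem i hi fun j _ hj => by
      rw [map_smul, LinearMap.smul_apply, horth hj, smul_zero]] at h0
    rw [map_smul, LinearMap.smul_apply, QuadraticMap.polarBilin_apply_apply,
      QuadraticMap.polar_self, hv] at h0
    simpa [hα0 i] using h0
  have := hli.fintype_card_le_finrank
  simp at this

end Forms

/-! ### A family of radicands with prescribed expansion -/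

lemma exists_mod_four_eq_two (v X Y : ℤ) (hv : v % 2 = 1)
    (hδ : (X ^ 2 + 2 * v * X * Y - Y ^ 2) ^ 2 = 1) :
    ∃ t : ℤ, ∀ t', t' ≡ t [ZMOD 4] →
      ((v * Y + X) ^ 2 * t' - (Y - v * X) ^ 2 *
          (X ^ 2 + Y ^ 2 + 2 * (X ^ 2 + 2 * v * X * Y - Y ^ 2))) *
        (Y ^ 2 * t' - X ^ 2 * (X ^ 2 + Y ^ 2 - 2 * (X ^ 2 + 2 * v * X * Y - Y ^ 2))) % 4 = 2 := by
  have key : ∀ v X Y : ZMod 4, v ^ 2 = 1 → (X ^ 2 + 2 * v * X * Y - Y ^ 2) ^ 2 = 1 → ∃ t : ZMod 4,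
      ((v * Y + X) ^ 2 * t - (Y - v * X) ^ 2 *
          (X ^ 2 + Y ^ 2 + 2 * (X ^ 2 + 2 * v * X * Y - Y ^ 2))) *
        (Y ^ 2 * t - X ^ 2 * (X ^ 2 + Y ^ 2 - 2 * (X ^ 2 + 2 * v * X * Y - Y ^ 2))) = 2 := by
    decide +kernel
  have hv' : (v : ZMod 4) ^ 2 = 1 := by
    obtain ⟨w, rfl⟩ : ∃ w, v = 2 * w + 1 := ⟨v / 2, by lia⟩
    have h4 : (4 : ZMod 4) = 0 := rfl
    push_cast
    linear_combination ((w : ZMod 4) ^ 2 + w) * h4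
  obtain ⟨t, ht⟩ := key v X Y hv' (by
    have := congrArg (Int.cast : ℤ → ZMod 4) hδ
    push_cast at this
    exact this)
  obtain ⟨t, rfl⟩ := ZMod.intCast_surjective t
  refine ⟨t, fun t' ht' => ?_⟩
  have e := (ZMod.intCast_eq_intCast_iff _ _ 4).2 ht'
  rw [← e] at ht
  have : ((v * Y + X) ^ 2 * t' - (Y - v * X) ^ 2 *
          (X ^ 2 + Y ^ 2 + 2 * (X ^ 2 + 2 * v * X * Y - Y ^ 2))) *
        (Y ^ 2 * t' - X ^ 2 * (X ^ 2 + Y ^ 2 - 2 * (X ^ 2 + 2 * v * X * Y - Y ^ 2))) ≡ 2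
        [ZMOD 4] := by
    apply (ZMod.intCast_eq_intCast_iff _ _ 4).1
    push_cast
    exact ht
  exact this

/-- The product of two linear polynomials with resultant `±1` takes squarefree values congruent to
`2` modulo `4` at arbitrarily large arguments, if it is `2` modulo `4` on a residue class. -/
lemma exists_squarefree_factors {P R c₁ c₂ δ t₀ : ℤ} (hP : 0 < P) (hR : 0 < R)
    (hres : R * c₁ - P * c₂ = δ) (hδ : δ ^ 2 = 1)
    (hmod : ∀ t, t ≡ t₀ [ZMOD 4] → (P * t - c₁) * (R * t - c₂) % 4 = 2) (b : ℤ) :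
    ∃ (t : ℤ) (D : ℕ), b ≤ t ∧ (D : ℤ) = (P * t - c₁) * (R * t - c₂) ∧ Squarefree D ∧
      D % 4 = 2 := by
  obtain ⟨t₁, ht₁, hmod₁⟩ : ∃ t₁ : ℤ, |b| + |c₁| + |c₂| + 1 ≤ t₁ ∧ t₁ ≡ t₀ [ZMOD 4] := by
    refine ⟨t₀ + 4 * (|t₀| + |b| + |c₁| + |c₂| + 1), ?_, by simp [Int.ModEq]⟩
    have := neg_abs_le t₀
    have := abs_nonneg b
    have := abs_nonneg t₀
    have := abs_nonneg c₁
    have := abs_nonneg c₂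
    lia
  have hb := abs_nonneg b
  have hc₁ := abs_nonneg c₁
  have hc₂ := abs_nonneg c₂
  have hb' := le_abs_self b
  have hc₁' := le_abs_self c₁
  have hc₂' := le_abs_self c₂
  have hL₁ : 0 < P * t₁ - c₁ := by nlinarith
  have hL₂ : 0 < R * t₁ - c₂ := by nlinarith
  obtain ⟨A₁, hA₁⟩ : ∃ A : ℕ, (A : ℤ) = P * 4 := ⟨(P * 4).toNat, by lia⟩
  obtain ⟨A₂, hA₂⟩ : ∃ A : ℕ, (A : ℤ) = R * 4 := ⟨(R * 4).toNat, by lia⟩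
  obtain ⟨B₁, hB₁⟩ : ∃ B : ℕ, (B : ℤ) = P * t₁ - c₁ := ⟨_, Int.toNat_of_nonneg hL₁.le⟩
  obtain ⟨B₂, hB₂⟩ : ∃ B : ℕ, (B : ℤ) = R * t₁ - c₂ := ⟨_, Int.toNat_of_nonneg hL₂.le⟩
  have e₁ : ∀ n : ℕ, ((A₁ * n + B₁ : ℕ) : ℤ) = P * (t₁ + 4 * n) - c₁ := fun n => by
    push_cast; rw [hA₁, hB₁]; ring
  have e₂ : ∀ n : ℕ, ((A₂ * n + B₂ : ℕ) : ℤ) = R * (t₁ + 4 * n) - c₂ := fun n => by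
    push_cast; rw [hA₂, hB₂]; ring
  have hmodn : ∀ n : ℕ, (A₁ * n + B₁) * (A₂ * n + B₂) % 4 = 2 := fun n => by
    have := hmod (t₁ + 4 * n) ((by simp [Int.ModEq] : t₁ + 4 * n ≡ t₁ [ZMOD 4]).trans hmod₁)
    rw [← e₁, ← e₂] at this
    exact_mod_cast this
  have h4 : ∀ a c : ℕ, a * c % 4 = 2 → ¬ 4 ∣ a ∧ ¬ 4 ∣ c := by
    refine fun a c h => ⟨?_, ?_⟩
    · rintro ⟨x, rfl⟩
      rw [mul_assoc] at h
      lia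
    · rintro ⟨x, rfl⟩
      rw [mul_left_comm] at h
      lia
  have hunit : IsUnit δ := IsUnit.of_mul_eq_one δ (by rw [← sq, hδ])
  have hne : ∀ p : ℕ, p.Prime → ¬ (p : ℤ) ∣ δ := fun p hp hd =>
    (Nat.prime_iff_prime_int.1 hp).not_isUnit (isUnit_of_dvd_unit hd hunit)
  have hcop₁ : ∀ p, p.Prime → p ∣ A₁ → p ∣ B₁ → p = 2 := by
    intro p hp hA hB
    have hA' : (p : ℤ) ∣ P * 4 := hA₁ ▸ Int.natCast_dvd_natCast.2 hA
    have hB' : (p : ℤ) ∣ P * t₁ - c₁ := hB₁ ▸ Int.natCast_dvd_natCast.2 hB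
    rcases (Nat.prime_iff_prime_int.1 hp).dvd_or_dvd hA' with h | h
    · exfalso
      have hc : (p : ℤ) ∣ c₁ := (dvd_sub_right (h.mul_right t₁)).1 hB'
      exact hne p hp (hres ▸ dvd_sub (hc.mul_left R) (h.mul_right c₂))
    · have h' : p ∣ 2 ^ 2 := by exact_mod_cast h
      exact (Nat.prime_dvd_prime_iff_eq hp Nat.prime_two).1 (hp.dvd_of_dvd_pow h')
  have hcop₂ : ∀ p, p.Prime → p ∣ A₂ → p ∣ B₂ → p = 2 := by
    intro p hp hA hB
    have hA' : (p : ℤ) ∣ R * 4 := hA₂ ▸ Int.natCast_dvd_natCast.2 hA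
    have hB' : (p : ℤ) ∣ R * t₁ - c₂ := hB₂ ▸ Int.natCast_dvd_natCast.2 hB
    rcases (Nat.prime_iff_prime_int.1 hp).dvd_or_dvd hA' with h | h
    · exfalso
      have hc : (p : ℤ) ∣ c₂ := (dvd_sub_right (h.mul_right t₁)).1 hB'
      exact hne p hp (hres ▸ dvd_sub (h.mul_right c₁) (hc.mul_left P))
    · have h' : p ∣ 2 ^ 2 := by exact_mod_cast h
      exact (Nat.prime_dvd_prime_iff_eq hp Nat.prime_two).1 (hp.dvd_of_dvd_pow h')
  obtain ⟨n, hn₁, hn₂⟩ := exists_squarefree_linear_pair A₁ B₁ A₂ B₂ (by lia) (by lia) hcop₁ hcop₂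
    (fun n => (h4 _ _ (hmodn n)).1) (fun n => (h4 _ _ (hmodn n)).2)
  refine ⟨t₁ + 4 * n, (A₁ * n + B₁) * (A₂ * n + B₂), by lia, ?_, ?_, hmodn n⟩
  · rw [← e₁, ← e₂]
    push_cast
    ring
  · refine (Nat.squarefree_mul (Nat.coprime_of_dvd fun p hp h₁ h₂ => ?_)).2 ⟨hn₁, hn₂⟩
    have h₁' := Int.natCast_dvd_natCast.2 h₁
    have h₂' := Int.natCast_dvd_natCast.2 h₂
    rw [e₁] at h₁'
    rw [e₂] at h₂'
    refine hne p hp ?_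
    have : δ = P * (R * (t₁ + 4 * n) - c₂) - R * (P * (t₁ + 4 * n) - c₁) := by rw [← hres]; ring
    rw [this]
    exact dvd_sub (h₂'.mul_left P) (h₁'.mul_left R)

/-- With `Uₙ = recSeq (2v) 0 1 n`, `X = Uᵣ`, `Y = Uᵣ₊₁`, `δ = X² + 2vXY - Y² = ±1`, the factors are
`D = ((vY + X)² t - (Y - vX)² (X² + Y² + 2δ)) (Y² t - X² (X² + Y² - 2δ))`, and
`k = t Y (vY + X) - (X² + Y²) X (Y - vX)`. -/
lemma exists_radicand (v r n₀ : ℕ) (hv : v % 2 = 1) :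
    ∃ D k : ℕ, n₀ ≤ k ∧ Squarefree D ∧ D % 4 = 2 ∧
      (D - k ^ 2 : ℤ) * recSeq (2 * v) 0 1 (2 * r + 2) =
        2 * k * recSeq (2 * v) 0 1 (2 * r + 1) + recSeq (2 * v) 0 1 (2 * r) := by
  obtain ⟨X, hX⟩ : ∃ X : ℤ, X = recSeq (2 * v) 0 1 r := ⟨_, rfl⟩
  obtain ⟨Y, hY⟩ : ∃ Y : ℤ, Y = recSeq (2 * v) 0 1 (r + 1) := ⟨_, rfl⟩
  have hY0 : 0 < Y := hY ▸ recSeq_zero_one_pos (by lia) r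
  have hX0 : 0 ≤ X := by
    rw [hX]
    cases r with
    | zero => simp
    | succ r => exact (recSeq_zero_one_pos (by lia) r).le
  have e1 : recSeq (2 * v) (0 : ℤ) 1 (2 * r + 1) = X ^ 2 + Y ^ 2 := by
    have := recSeq_add (2 * v) (0 : ℤ) 1 r r
    rw [← hX, ← hY] at this
    rw [two_mul r, this]
    ring
  have e2 : recSeq (2 * v) (0 : ℤ) 1 (2 * r + 2) = 2 * (Y * (v * Y + X)) := by
    have := recSeq_add (2 * v) (0 : ℤ) 1 (r + 1) r
    rw [recSeq_add_two, ← hX, ← hY] at this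
    rw [show 2 * r + 2 = r + 1 + r + 1 by ring, this]
    push_cast
    ring
  have e0 : recSeq (2 * v) (0 : ℤ) 1 (2 * r) = 2 * (X * (Y - v * X)) := by
    have := recSeq_add_two (2 * v) (0 : ℤ) 1 (2 * r)
    rw [e1, e2] at this
    push_cast at this
    linear_combination -this
  obtain ⟨δ, hδ⟩ : ∃ δ : ℤ, δ = X ^ 2 + 2 * v * X * Y - Y ^ 2 := ⟨_, rfl⟩
  have hδ1 : δ ^ 2 = 1 := by
    have := recSeq_norm (2 * v) (0 : ℤ) 1 r
    rw [← hX, ← hY] at this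
    push_cast at this
    rw [hδ, this, mul_pow, ← pow_mul, mul_comm r 2, pow_mul]
    simp
  obtain ⟨t₀, ht₀⟩ := exists_mod_four_eq_two v X Y (by lia) (hδ ▸ hδ1)
  rw [← hδ] at ht₀
  have hv0 : (0 : ℤ) < v := by lia
  have hT : 0 < v * Y + X := by positivity
  obtain ⟨t, D, htb, hD, hsq, hD4⟩ := exists_squarefree_factors (P := (v * Y + X) ^ 2)
    (R := Y ^ 2) (by positivity) (by positivity) (δ := δ) (by
      -- By `B ∓ δ = 2 Y (Y - vX)`, `2 X (vY + X)` for `B = X² + Y²`, the resultant is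
      -- `((B - δ)² (B + 2δ) - (B + δ)² (B - 2δ)) / 4 = δ³`.
      have h3 : Y ^ 2 * ((Y - v * X) ^ 2 * (X ^ 2 + Y ^ 2 + 2 * δ)) -
          (v * Y + X) ^ 2 * (X ^ 2 * (X ^ 2 + Y ^ 2 - 2 * δ)) = δ ^ 3 := by rw [hδ]; ring
      linear_combination h3 + δ * hδ1) hδ1 ht₀
    (|(X ^ 2 + Y ^ 2) * (X * (Y - v * X))| + n₀)
  have hk : n₀ ≤ t * (Y * (v * Y + X)) - (X ^ 2 + Y ^ 2) * (X * (Y - v * X)) := by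
    have h1 := le_abs_self ((X ^ 2 + Y ^ 2) * (X * (Y - v * X)))
    have h2 : 0 < Y * (v * Y + X) := by positivity
    have h3 := abs_nonneg ((X ^ 2 + Y ^ 2) * (X * (Y - v * X)))
    have h4 : t ≤ t * (Y * (v * Y + X)) := le_mul_of_one_le_right (by lia) h2
    linarith
  obtain ⟨k, hk'⟩ : ∃ k : ℕ,
      (k : ℤ) = t * (Y * (v * Y + X)) - (X ^ 2 + Y ^ 2) * (X * (Y - v * X)) :=
    ⟨_, Int.toNat_of_nonneg (by lia)⟩
  refine ⟨D, k, by lia, hsq, hD4, ?_⟩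
  rw [e0, e1, e2]
  have hDk : (D : ℤ) - k ^ 2 = t * (X ^ 2 + Y ^ 2) - 4 * (X * (Y - v * X)) ^ 2 := by
    rw [hD, hk']
    rw [hδ] at hδ1 ⊢
    linear_combination (t * (X ^ 2 + Y ^ 2) - 4 * (X * (Y - v * X)) ^ 2) * hδ1
  rw [hDk, hk']
  rw [hδ] at hδ1
  linear_combination 2 * (X * (Y - v * X)) * hδ1

/-! ### Fields without universal forms -/

/-- The integral equation satisfied by `D` and `k` says that `√D - k` is the reciprocal of the first
complete quotient. -/
lemma recSeq_mul_sub_of_radicand {u k ℓ D : ℕ}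
    (h : (D - k ^ 2 : ℤ) * recSeq u 0 1 (ℓ + 2) =
      2 * k * recSeq u 0 1 (ℓ + 1) + recSeq u 0 1 ℓ) :
    recSeq u 1 (k + √(D : ℝ)) (ℓ + 2) * (√(D : ℝ) - k) = recSeq u 1 (k + √(D : ℝ)) (ℓ + 1) := by
  have hω := Real.mul_self_sqrt (Nat.cast_nonneg (α := ℝ) D)
  have hcast : ∀ n, ((recSeq u (0 : ℤ) 1 n : ℤ) : ℝ) = recSeq u 0 1 n := fun n => by
    simpa using map_recSeq u (0 : ℤ) 1 (Int.castRingHom ℝ) n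
  have h' := congrArg (Int.cast : ℤ → ℝ) h
  push_cast [hcast] at h'
  have e1 := recSeq_add u (1 : ℝ) (k + √(D : ℝ)) 0 (ℓ + 1)
  have e2 := recSeq_add u (1 : ℝ) (k + √(D : ℝ)) 0 ℓ
  simp only [zero_add, recSeq_zero, recSeq_one, mul_one] at e1 e2
  rw [e1, e2]
  linear_combination h' + recSeq u (0 : ℝ) 1 (ℓ + 2) * hω

lemma not_admitsClassicalUniversalForm_adjoin_sqrt {M u k ℓ D : ℕ} (hsq : Squarefree D)
    (hD : D % 4 = 2) (hu : 1 ≤ u) (hk : u + 1 ≤ k)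
    (h : recSeq u 1 (k + √(D : ℝ)) (ℓ + 1) * (√(D : ℝ) - k) = recSeq u 1 (k + √(D : ℝ)) ℓ)
    (hℓ : Odd ℓ) (hM : 2 * M ≤ ℓ + 1) :
    ¬ AdmitsClassicalUniversalForm ℚ⟮√(D : ℝ)⟯ M := by
  obtain ⟨θ, τ, hθ, hτ, hbasis⟩ := exists_sqrt_basis hsq hD
  have hω : 0 < √(D : ℝ) := Real.sqrt_pos.2 (by exact_mod_cast Nat.pos_of_ne_zero hsq.ne_zero)
  have hθ2 : ∀ σ : ℚ⟮√(D : ℝ)⟯ →+* ℝ, σ θ = √(D : ℝ) ∨ σ θ = -√(D : ℝ) := by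
    intro σ
    have e : (θ : ℚ⟮√(D : ℝ)⟯) ^ 2 = D := by
      apply (algebraMap ℚ⟮√(D : ℝ)⟯ ℝ).injective
      rw [map_pow, hθ, map_natCast, Real.sq_sqrt (Nat.cast_nonneg _)]
    rw [← sq_eq_sq_iff_eq_or_eq_neg, ← map_pow, e, map_natCast, Real.sq_sqrt (Nat.cast_nonneg _)]
  have hσ : ∀ (σ : ℚ⟮√(D : ℝ)⟯ →+* ℝ) (n : ℕ),
      σ (recSeq u 1 (k + θ) n : 𝓞 ℚ⟮√(D : ℝ)⟯) = recSeq u 1 (k + σ θ) n := fun σ n => by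
    have := map_recSeq u (1 : 𝓞 ℚ⟮√(D : ℝ)⟯) (k + θ)
      (σ.comp (algebraMap (𝓞 ℚ⟮√(D : ℝ)⟯) ℚ⟮√(D : ℝ)⟯)) n
    simpa using this
  have main : ∀ i j : ℕ, i < j → j ≤ M → ∀ b : 𝓞 ℚ⟮√(D : ℝ)⟯,
      (∀ σ : ℚ⟮√(D : ℝ)⟯ →+* ℝ, σ b ^ 2 ≤ σ (recSeq u 1 (k + θ) (2 * i) : 𝓞 ℚ⟮√(D : ℝ)⟯) *
        σ (recSeq u 1 (k + θ) (2 * j) : 𝓞 ℚ⟮√(D : ℝ)⟯)) → b = 0 := by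
    intro i j hij hjM b hb
    obtain ⟨x, y, rfl⟩ := hbasis b
    obtain ⟨s, rfl⟩ : ∃ s, j = i + (s + 1) := ⟨j - i - 1, by lia⟩
    obtain ⟨c, d, hcd⟩ := recSeq_combination u k θ x y (2 * i + s)
    rw [hcd] at hb ⊢
    have hval : ∀ σ : ℚ⟮√(D : ℝ)⟯ →+* ℝ,
        σ (c * recSeq u 1 (k + θ) (2 * i + s + 1) + d * recSeq u 1 (k + θ) (2 * i + s) :
          𝓞 ℚ⟮√(D : ℝ)⟯) =
        c * recSeq u 1 (k + σ θ) (2 * i + s + 1) + d * recSeq u 1 (k + σ θ) (2 * i + s) := by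
      intro σ
      rw [← hσ, ← hσ]
      simp
    have h1 := hb (algebraMap ℚ⟮√(D : ℝ)⟯ ℝ)
    have h2 := hb τ
    rw [hval, hσ, hσ, hθ, mul_add 2 i (s + 1)] at h1
    rw [hval, hσ, hσ, hτ, mul_add 2 i (s + 1), ← sub_eq_add_neg] at h2
    obtain ⟨rfl, rfl⟩ := eq_zero_of_sq_le_recSeq_mul hu hk hω h (t := ℓ + 1 - 2 * (i + (s + 1)))
      (even_two_mul i) (by rw [Nat.even_sub (by lia)]; simp [hℓ.add_one]) (by lia) c d h1 h2
    simp
  refine not_admitsClassicalUniversalForm_of_family τ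
    (fun i : Fin (M + 1) => recSeq u 1 (k + θ) (2 * (i : ℕ))) (fun i σ => ?_) fun i j hij b hb => ?_
  · rw [hσ]
    rcases hθ2 σ with e | e <;> rw [e]
    · have hu' : (1 : ℝ) ≤ u := by exact_mod_cast hu
      have hk' : (u : ℝ) + 1 ≤ k := by exact_mod_cast hk
      exact (recSeq_pos_and_lt hu one_pos (by linarith) _).1
    · rw [← sub_eq_add_neg]
      exact recSeq_conj_pos hu (by lia) hω h (by lia) (even_two_mul _)
  · rcases lt_or_gt_of_ne hij with h | h
    · exact main i j h (by lia) b hb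
    · exact main j i h (by lia) b fun σ => by rw [mul_comm]; exact hb σ

lemma infinite_radicands (M : ℕ) {u ℓ : ℕ} (hu : u % 4 = 2) (hℓ : Odd ℓ) (hM : 2 * M ≤ ℓ + 1) :
    {D : ℕ | (Squarefree D ∧ D % 4 = 2) ∧ (∃ k, HasPeriodicExpansion √(D : ℝ) k u ℓ) ∧
      ¬ AdmitsClassicalUniversalForm ℚ⟮√(D : ℝ)⟯ M}.Infinite := by
  refine Set.infinite_of_forall_exists_gt fun N => ?_
  obtain ⟨r, rfl⟩ := hℓ
  obtain ⟨v, rfl⟩ : ∃ v, u = 2 * v := ⟨u / 2, by lia⟩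
  obtain ⟨D, k, hk, hsq, hD, hrel⟩ := exists_radicand v r (2 * v + 1 + N) (by lia)
  have h := recSeq_mul_sub_of_radicand hrel
  have hω : 0 < √(D : ℝ) := Real.sqrt_pos.2 (by exact_mod_cast Nat.pos_of_ne_zero hsq.ne_zero)
  refine ⟨D, ⟨⟨hsq, hD⟩,
    ⟨k, hasPeriodicExpansion_of_recSeq (by lia) (by lia) hω h⟩,
    not_admitsClassicalUniversalForm_adjoin_sqrt hsq hD (by lia) (by lia) h (odd_two_mul_add_one r)
      hM⟩, ?_⟩
  have hkD : (k : ℝ) < √(D : ℝ) := by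
    have hk1 : (1 : ℝ) ≤ k := by exact_mod_cast (by lia : 1 ≤ k)
    have hW := fun m => (recSeq_pos_and_lt (u := 2 * v) (by lia) one_pos
      (show (1 : ℝ) < k + √(D : ℝ) by linarith) m).1
    have := pos_of_mul_pos_right (h ▸ hW _) (hW _).le
    linarith
  have h2 : k ^ 2 < D := by
    have := (Real.lt_sqrt (Nat.cast_nonneg k)).1 hkD
    exact_mod_cast this
  nlinarith

theorem theorem1 (M : ℕ) (hM : 0 < M) :
    {K : IntermediateField ℚ ℝ |
        Module.finrank ℚ K = 2 ∧ ¬ AdmitsClassicalUniversalForm K M}.Infinite ∧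
    ∀ u ℓ : ℕ, 6 ≤ u → u % 4 = 2 → Squarefree (u ^ 2 / 4 + 1) → Odd ℓ → 4 * M + 2 ≤ ℓ →
      {K : IntermediateField ℚ ℝ |
        (∃ D k : ℕ, Squarefree D ∧ D % 4 = 2 ∧ HasPeriodicExpansion (√(D : ℝ)) k u ℓ ∧
          K = ℚ⟮√(D : ℝ)⟯) ∧
        ¬ AdmitsClassicalUniversalForm K M}.Infinite := by
  constructor
  · refine ((infinite_radicands M (u := 6) (ℓ := 2 * M + 1) rfl (odd_two_mul_add_one M)
      (by lia)).image (adjoin_sqrt_injOn.mono fun D hD => hD.1)).mono ?_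
    rintro _ ⟨D, ⟨⟨_, hD⟩, _, hadm⟩, rfl⟩
    exact ⟨finrank_adjoin_sqrt (not_isSquare_of_mod_four hD), hadm⟩
  · intro u ℓ _ hu _ hℓ hMℓ
    refine ((infinite_radicands M hu hℓ (by lia)).image
      (adjoin_sqrt_injOn.mono fun D hD => hD.1)).mono ?_
    rintro _ ⟨D, ⟨⟨hsq, hD⟩, ⟨k, hk⟩, hadm⟩, rfl⟩
    exact ⟨⟨D, k, hsq, hD, hk, rfl⟩, hadm⟩
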